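/- For $n\in\mathbb{N}=\{1,2,\dots\}$ let $f_{dsq}(n)\in\mathbb{N}_0$ be the number of partitions of $n$ into distinct squares of positive integers. A function $f:\mathbb{N}\to\mathbb{Z}$ is called a PIO function (polynomial in input and output) if there are a multitape Turing machine and constants $c,d\in\mathbb{N}$ such that for every $n\in\mathbb{N}$ the machine, on input $n$, computes $f(n)$ (both numbers are written in binary) in at most $c\cdot m_f(n)^d$ steps, where $$m_f(n)=\log(1+n)+\log(2+|f(n)|).$$ Then the following holds. (1) The function $f_{dsq}$ is a PIO function. (2) For every $n\in\mathbb{N}$, $f_{dsq}(n)$ equals the number of partitions of $n$ in which each $i\in\mathbb{N}$ occurs as a part with multiplicity either $0$ or $i$. (3) The number $128$ is the largest nonnegative integer that is not a sum of distinct squares of positive integers (with $0$ being the empty sum). (4) There are real constants $C,c>0$ such that $f_{dsq}(n)\ge C\exp(c\,n^{1/3})$ for every integer $n\ge129$. -/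

import Mathlib

/-- A deterministic multitape Turing machine: finitely many two-way infinite tapes over a finite
alphabet whose blank symbol is `default`, and finitely many control states. The letters `bit false`
and `bit true` are two distinct nonblank symbols, used for input and output. A transition reads all
the scanned symbols; `none` means that the machine halts, and `some (q, a)` means that the machine
enters state `q` and on each tape `k` writes the symbol `(a k).1` and then moves its head by one
cell in the direction `(a k).2` (with `none` the head stays). -/
structure MultitapeTM where
  /-- The tapes. -/
  Idx : Type
  /-- The alphabet. -/
  Sym : Type
  /-- The control states. -/
  State : Type
  [fintypeIdx : Fintype Idx]
  [decEqIdx : DecidableEq Idx]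
  [fintypeSym : Fintype Sym]
  [inhabitedSym : Inhabited Sym]
  [fintypeState : Fintype State]
  bit : Bool → Sym
  bit_injective : Function.Injective bit
  bit_ne_blank : ∀ b, bit b ≠ default
  start : State
  input : Idx
  output : Idx
  trans : State → (Idx → Sym) → Option (State × (Idx → Sym × Option Turing.Dir))

namespace MultitapeTM

attribute [instance] fintypeIdx decEqIdx fintypeSym inhabitedSym fintypeState

/-- A configuration: the control state and the tapes with their heads. -/
structure Cfg (M : MultitapeTM) where
  state : M.State
  tape : M.Idx → Turing.Tape M.Sym

/-- A tape that holds the binary word `w` and is blank elsewhere, with the head on the first letter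
of `w`. -/
def wordTape (M : MultitapeTM) (w : List Bool) : Turing.Tape M.Sym :=
  Turing.Tape.mk₁ (w.map M.bit)

/-- The initial configuration on input `w`: `w` is on the input tape, all other tapes are blank. -/
def init (M : MultitapeTM) (w : List Bool) : M.Cfg where
  state := M.start
  tape k := if k = M.input then M.wordTape w else M.wordTape []

/-- Write a symbol and then move the head by at most one cell. -/
def act {Γ : Type} [Inhabited Γ] (T : Turing.Tape Γ) (a : Γ × Option Turing.Dir) :
    Turing.Tape Γ :=
  match a.2 with
  | none => T.write a.1
  | some d => (T.write a.1).move d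

/-- One step of the machine; `none` if the machine halts. -/
def step (M : MultitapeTM) (C : M.Cfg) : Option M.Cfg :=
  (M.trans C.state fun k => (C.tape k).head).map fun r =>
    { state := r.1, tape := fun k => act (C.tape k) (r.2 k) }

/-- The configuration after `t` steps from `C` (`none` if the machine halts earlier). -/
def run (M : MultitapeTM) (C : M.Cfg) : ℕ → Option M.Cfg
  | 0 => some C
  | t + 1 => (M.run C t).bind M.step

/-- On input `w` the machine halts after exactly `t` steps, and then the output tape holds `v`. -/
def OutputsIn (M : MultitapeTM) (w v : List Bool) (t : ℕ) : Prop :=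
  ∃ C : M.Cfg, M.run (M.init w) t = some C ∧ M.step C = none ∧ C.tape M.output = M.wordTape v

end MultitapeTM

/-- The binary code of an integer: a sign bit (`true` for negative integers) followed by the binary
digits of the absolute value, least significant digit first. -/
def intCode (z : ℤ) : List Bool :=
  decide (z < 0) :: z.natAbs.bits

/-- The combined complexity `m_f(n)` of the input `n` and the output `f n`. -/
noncomputable def inOutComplexity (f : ℕ → ℤ) (n : ℕ) : ℝ :=
  Real.log (1 + (n : ℝ)) + Real.log (2 + |(f n : ℝ)|)

/-- `f`, as a function on the positive integers, is a PIO function: some multitape Turing machine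
computes `f n` from `n` (both written in binary) in at most `c * m_f(n) ^ d` steps, with constants
`c` and `d`. -/
def IsPIO (f : ℕ → ℤ) : Prop :=
  ∃ (M : MultitapeTM) (c d : ℕ), 0 < c ∧ 0 < d ∧ ∀ n : ℕ, 1 ≤ n →
    ∃ t : ℕ, (t : ℝ) ≤ (c : ℝ) * inOutComplexity f n ^ d ∧
      M.OutputsIn n.bits (intCode (f n)) t

/-- The number of partitions of `n` into distinct squares (of positive integers: the parts of a
partition are positive). -/
noncomputable def distinctSquarePartitions (n : ℕ) : ℕ :=
  Nat.card {p : n.Partition // p.parts.Nodup ∧ ∀ i ∈ p.parts, IsSquare i}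

/-- The number of partitions of `n` in which each positive integer `i` occurs as a part either `0`
or `i` times. -/
noncomputable def selfMultiplicityPartitions (n : ℕ) : ℕ :=
  Nat.card {p : n.Partition // ∀ i : ℕ, 1 ≤ i → p.parts.count i = 0 ∨ p.parts.count i = i}

/-! Both kinds of partitions of `n` correspond to finite sets `S` of positive integers with `∑ i ∈
S, i ^ 2 = n` (`SquareSet n`): such an `S` yields the distinct parts `i ^ 2`, or else `i` copies of
each part `i`.

The growth bound comes from separating multiples of 5 from the rest. Every integer from 189 on is a
sum of distinct squares of integers prime to 5 (`exists_sum_sq_not_five_dvd`: a finite check, then a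
greedy step). Hence every subset of `{5, 10, ..., 5k}` extends to a member of `SquareSet n` once `25
* k ^ 3 + 189 ≤ n`, and different subsets stay different. This gives at least `2 ^ k` sets with `k`
of order `n ^ (1/3)` (`two_pow_le_card_squareSet`). The finite checks also settle 128 and the range
from 129 to 188.

Consequently `m_f(n)` is at least a constant times `n ^ (1/3)`, and for PIO a running time
polynomial in `n`, rather than in the length of `n`, is enough. The algorithm is Kronecker
substitution: the generating polynomial `∏ (1 + X ^ (j ^ 2))`, `1 ≤ j ≤ n`, is evaluated at `X = 2 ^
(n + 1)`. Its coefficients add up to `2 ^ n`, so they do not overlap in binary, and the block number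
`n` of `n + 1` digits is the answer (`prod_div_mod`). Each factor costs one shift and one addition.
The algorithm is written as a program on stacks of bits, each stack being kept on one tape
(`Exec.leads`). -/

/-! ### Stack programs and their translation into multitape Turing machines -/

/-- Structured programs over finitely many stacks of bits. -/
inductive StackProg (K : Type) : Type
  | skip : StackProg K
  | push (k : K) (b : Bool) : StackProg K
  | pop (k : K) : StackProg K
  | seq (p q : StackProg K) : StackProg K
  | branch (k : K) (p q r : StackProg K) : StackProg K
  | loop (k : K) (p : StackProg K) : StackProg K

namespace StackProg

variable {K : Type}

/-- The control states of the machine that runs a program. -/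
def State : StackProg K → Type
  | skip => Unit
  | push _ _ => Bool
  | pop _ => Unit
  | seq p q => p.State ⊕ q.State
  | branch _ p q r => Option (p.State ⊕ q.State ⊕ r.State)
  | loop _ p => Option p.State

theorem finite_state (p : StackProg K) : Finite p.State := by
  induction p with
  | skip => exact inferInstanceAs (Finite Unit)
  | push => exact inferInstanceAs (Finite Bool)
  | pop => exact inferInstanceAs (Finite Unit)
  | seq p q => exact inferInstanceAs (Finite (p.State ⊕ q.State))
  | branch k p q r => exact inferInstanceAs (Finite (Option (p.State ⊕ q.State ⊕ r.State)))
  | loop k p => exact inferInstanceAs (Finite (Option p.State))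

/-- The state in which a program starts. -/
def entry : (p : StackProg K) → p.State
  | skip => ()
  | push _ _ => false
  | pop _ => ()
  | seq p _ => Sum.inl p.entry
  | branch _ _ _ _ => none
  | loop _ _ => none

variable [DecidableEq K]

/-- What a transition writes on the tapes and how it moves the heads. -/
abbrev Action (K : Type) : Type := K → Option Bool × Option Turing.Dir

/-- The action that changes nothing, when the symbols `h` are scanned. -/
def keep (h : K → Option Bool) : Action K := fun k => (h k, none)

/-- The transition function of the machine that runs a program; the new state `none` means that the
program is finished. -/
def next : (p : StackProg K) → p.State → (K → Option Bool) → Option p.State × Action K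
  | skip, _, h => (none, keep h)
  -- A machine step writes before it moves, so a push takes two steps: go left, then write.
  | push k _, false, h => (some true, Function.update (keep h) k (h k, some Turing.Dir.left))
  | push k b, true, h => (none, Function.update (keep h) k (some b, none))
  | pop k, _, h => (none, Function.update (keep h) k (none, some Turing.Dir.right))
  | seq p q, Sum.inl s, h =>
      (some ((p.next s h).1.elim (Sum.inr q.entry) Sum.inl), (p.next s h).2)
  | seq _ q, Sum.inr s, h => ((q.next s h).1.map Sum.inr, (q.next s h).2)
  | branch k p q r, none, h =>
      (some (some (match h k with
        | none => Sum.inl p.entry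
        | some false => Sum.inr (Sum.inl q.entry)
        | some true => Sum.inr (Sum.inr r.entry))), keep h)
  | branch _ p _ _, some (Sum.inl s), h =>
      ((p.next s h).1.map fun s => some (Sum.inl s), (p.next s h).2)
  | branch _ _ q _, some (Sum.inr (Sum.inl s)), h =>
      ((q.next s h).1.map fun s => some (Sum.inr (Sum.inl s)), (q.next s h).2)
  | branch _ _ _ r, some (Sum.inr (Sum.inr s)), h =>
      ((r.next s h).1.map fun s => some (Sum.inr (Sum.inr s)), (r.next s h).2)
  | loop k p, none, h =>
      (match h k with
        | none => none
        | some _ => some (some p.entry), keep h)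
  -- The value `none` of `(p.next s h).1`, the end of the body, is at the same time the state of the
  -- loop that tests the stack.
  | loop _ p, some s, h => (some (p.next s h).1, (p.next s h).2)

/-- The tapes of the machine. -/
abbrev Tapes (K : Type) : Type := K → Turing.Tape (Option Bool)

/-- The symbols under the heads. -/
def heads (T : Tapes K) : K → Option Bool := fun k => (T k).head

/-- Perform an action on the tapes. -/
def perform (T : Tapes K) (a : Action K) : Tapes K := fun k => MultitapeTM.act (T k) (a k)

/-- Started in state `s` on the tapes `T`, the program is finished after `t` steps, and then the
tapes are `T'`. -/
inductive Leads (p : StackProg K) : p.State → Tapes K → ℕ → Tapes K → Prop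
  | last {s T} (h : (p.next s (heads T)).1 = none) :
      Leads p s T 1 (perform T (p.next s (heads T)).2)
  | step {s s' T t T'} (h : (p.next s (heads T)).1 = some s')
      (h' : Leads p s' (perform T (p.next s (heads T)).2) t T') : Leads p s T (t + 1) T'

@[simp]
theorem perform_keep {K : Type} (T : Tapes K) : perform T (keep (heads T)) = T := by
  funext k
  simp [perform, keep, heads, MultitapeTM.act]

/-- The contents of the stacks. -/
abbrev Store (K : Type) : Type := K → List Bool

/-- The tapes that hold the given stacks, with the heads on their tops. -/
def tapes (σ : Store K) : Tapes K := fun k => Turing.Tape.mk₁ ((σ k).map some)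

theorem heads_tapes {K : Type} (σ : Store K) (k : K) : heads (tapes σ) k = (σ k).head? := by
  cases h : σ k <;> simp [heads, tapes, h, Turing.Tape.mk₁, Turing.Tape.mk₂, Turing.Tape.mk']
  rfl

/-- A state map that commutes with the transitions, also at the end of the program, carries runs to
runs. -/
theorem Leads.map {p q : StackProg K} (f : p.State → q.State)
    (hf : ∀ s h, q.next (f s) h = ((p.next s h).1.map f, (p.next s h).2)) {s T t T'}
    (H : Leads p s T t T') : Leads q (f s) T t T' := by
  induction H with
  | @last s T h =>
    have := Leads.last (p := q) (s := f s) (T := T) (by simp [hf, h])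
    simpa [hf] using this
  | @step s s' T t T' h _ ih =>
    refine Leads.step (p := q) (s := f s) (s' := f s') (by simp [hf, h]) ?_
    simpa [hf] using ih

/-- A state map that commutes with the transitions, except that the end of the program leads to the
state `e`, from which the run goes on. -/
theorem Leads.trans {p q : StackProg K} (f : p.State → q.State) (e : q.State)
    (hf : ∀ s h, q.next (f s) h = (some ((p.next s h).1.elim e f), (p.next s h).2)) {s T t T' t' T''}
    (H : Leads p s T t T') (H' : Leads q e T' t' T'') : Leads q (f s) T (t' + t) T'' := by
  induction H with
  | @last s T h =>
    refine Leads.step (p := q) (s := f s) (s' := e) (by simp [hf, h]) ?_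
    simpa [hf] using H'
  | @step s s' T t T' h _ ih =>
    refine Leads.step (p := q) (s := f s) (s' := f s') (by simp [hf, h]) ?_
    simpa [hf] using ih H'

/-- `Exec p σ t σ'`: the program `p` changes the stacks from `σ` to `σ'` in `t` steps. -/
inductive Exec : StackProg K → Store K → ℕ → Store K → Prop
  | skip {σ} : Exec skip σ 1 σ
  | push {k b σ} : Exec (push k b) σ 2 (Function.update σ k (b :: σ k))
  | pop {k σ} : Exec (pop k) σ 1 (Function.update σ k (σ k).tail)
  | seq {p q σ σ' σ'' t t'} (h : Exec p σ t σ') (h' : Exec q σ' t' σ'') :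
      Exec (seq p q) σ (t' + t) σ''
  | branch_nil {k p q r σ σ' t} (hk : σ k = []) (h : Exec p σ t σ') :
      Exec (branch k p q r) σ (t + 1) σ'
  | branch_false {k p q r σ σ' t l} (hk : σ k = false :: l) (h : Exec q σ t σ') :
      Exec (branch k p q r) σ (t + 1) σ'
  | branch_true {k p q r σ σ' t l} (hk : σ k = true :: l) (h : Exec r σ t σ') :
      Exec (branch k p q r) σ (t + 1) σ'
  | loop_nil {k p σ} (hk : σ k = []) : Exec (loop k p) σ 1 σ
  | loop_cons {k p σ σ' σ'' t t' b l} (hk : σ k = b :: l) (h : Exec p σ t σ')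
      (h' : Exec (loop k p) σ' t' σ'') : Exec (loop k p) σ (t' + t + 1) σ''

theorem act_write_move_left (l : List (Option Bool)) (b : Option Bool) :
    MultitapeTM.act (MultitapeTM.act (Turing.Tape.mk₁ l)
      ((Turing.Tape.mk₁ l).head, some Turing.Dir.left)) (b, none) = Turing.Tape.mk₁ (b :: l) := by
  simp only [MultitapeTM.act, Turing.Tape.write_self, Turing.Tape.mk₁, Turing.Tape.mk₂]
  rw [← Turing.ListBlank.cons_head_tail (Turing.ListBlank.mk ([] : List (Option Bool))),
    Turing.Tape.move_left_mk', Turing.Tape.write_mk']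
  simp only [Turing.ListBlank.tail_mk, Turing.ListBlank.cons_mk]
  congr 1
  exact (Turing.ListBlank.cons_head_tail (Turing.ListBlank.mk ([] : List (Option Bool)))).symm

/-- The popped cell is blanked, so everything left of the head stays blank and the tape is again
exactly the tape of a stack. The final output tape therefore holds nothing but the output. -/
theorem act_blank_move_right (l : List (Option Bool)) :
    MultitapeTM.act (Turing.Tape.mk₁ l) (none, some Turing.Dir.right) =
      Turing.Tape.mk₁ l.tail := by
  simp only [MultitapeTM.act, Turing.Tape.mk₁, Turing.Tape.mk₂]
  rw [← Turing.ListBlank.cons_head_tail (Turing.ListBlank.mk l), Turing.Tape.write_mk',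
    Turing.Tape.move_right_mk', Turing.ListBlank.tail_mk]
  congr 1
  exact (Turing.ListBlank.cons_head_tail (Turing.ListBlank.mk ([] : List (Option Bool))))

/-- Correctness of the translation, with the same step count: `Leads.map` embeds a subprogram that
ends together with the whole, `Leads.trans` one after which the run goes on. -/
theorem Exec.leads {p : StackProg K} {σ σ' : Store K} {t : ℕ} (H : Exec p σ t σ') :
    Leads p p.entry (tapes σ) t (tapes σ') := by
  induction H with
  | @skip σ =>
    have := Leads.last (p := StackProg.skip) (s := ()) (T := tapes σ) rfl
    rwa [show (StackProg.skip : StackProg K).next () (heads (tapes σ)) = (none, keep _) from rfl,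
      perform_keep] at this
  | @push k b σ =>
    have := Leads.step (p := StackProg.push k b) (s := false) (s' := true) (T := tapes σ) rfl
      (Leads.last rfl)
    refine Eq.subst (motive := Leads _ _ _ _) ?_ this
    funext j
    by_cases hj : j = k
    · subst hj
      simpa [next, perform, heads, tapes] using act_write_move_left ((σ j).map some) (some b)
    · simp [next, perform, heads, tapes, hj, keep, MultitapeTM.act]
  | @pop k σ =>
    have := Leads.last (p := StackProg.pop k) (s := ()) (T := tapes σ) rfl
    refine Eq.subst (motive := Leads _ _ _ _) ?_ this
    funext j
    by_cases hj : j = k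
    · subst hj
      simpa [next, perform, heads, tapes] using act_blank_move_right ((σ j).map some)
    · simp [next, perform, heads, tapes, hj, keep, MultitapeTM.act]
  | @seq p q _ _ _ _ _ _ _ ih ih' =>
    exact Leads.trans (q := StackProg.seq p q) Sum.inl _ (fun _ _ => rfl) ih
      (ih'.map (q := StackProg.seq p q) Sum.inr fun _ _ => rfl)
  | @branch_nil k p q r σ _ _ hk _ ih =>
    refine Leads.step (p := branch k p q r) (s := none) (s' := some (Sum.inl p.entry)) ?_ ?_
    · simp [next, heads_tapes, hk]
    · rw [next, perform_keep]
      exact ih.map (q := branch k p q r) (fun s => some (Sum.inl s)) fun _ _ => rfl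
  | @branch_false k p q r σ _ _ l hk _ ih =>
    refine Leads.step (p := branch k p q r) (s := none)
      (s' := some (Sum.inr (Sum.inl q.entry))) ?_ ?_
    · simp [next, heads_tapes, hk]
    · rw [next, perform_keep]
      exact ih.map (q := branch k p q r) (fun s => some (Sum.inr (Sum.inl s))) fun _ _ => rfl
  | @branch_true k p q r σ _ _ l hk _ ih =>
    refine Leads.step (p := branch k p q r) (s := none)
      (s' := some (Sum.inr (Sum.inr r.entry))) ?_ ?_
    · simp [next, heads_tapes, hk]
    · rw [next, perform_keep]
      exact ih.map (q := branch k p q r) (fun s => some (Sum.inr (Sum.inr s))) fun _ _ => rfl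
  | @loop_nil k p σ hk =>
    have := Leads.last (p := loop k p) (s := none) (T := tapes σ) (by simp [next, heads_tapes, hk])
    rwa [next, perform_keep] at this
  | @loop_cons k p σ _ _ _ _ b l hk _ _ ih ih' =>
    refine Leads.step (p := loop k p) (s := none) (s' := some p.entry) ?_ ?_
    · simp [next, heads_tapes, hk]
    · rw [next, perform_keep]
      refine Leads.trans (q := loop k p) some none (fun s h => ?_) ih ih'
      cases hs : (p.next s h).1 <;> simp only [next, hs] <;> rfl

/-- The machine that runs a program. -/
noncomputable def machine [Fintype K] (p : StackProg K) (i o : K) : MultitapeTM where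
  Idx := K
  Sym := Option Bool
  State := Option p.State
  fintypeState := haveI := p.finite_state; Fintype.ofFinite _
  bit := some
  bit_injective := Option.some_injective _
  bit_ne_blank _ := by simp
  start := some p.entry
  input := i
  output := o
  trans s h := s.map (p.next · h)

theorem Leads.run_machine [Fintype K] {p : StackProg K} {i o : K} {s : p.State} {T T' : Tapes K}
    {t : ℕ} (H : Leads p s T t T') (C : (p.machine i o).Cfg) (u : ℕ)
    (hC : (p.machine i o).run C u = some { state := some s, tape := T }) :
    (p.machine i o).run C (u + t) = some { state := none, tape := T' } := by
  induction H generalizing u with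
  | @last s T h =>
    rw [MultitapeTM.run, hC, ← h]
    rfl
  | @step s s' T t T' h _ ih =>
    rw [add_comm t 1, ← add_assoc]
    apply ih
    rw [MultitapeTM.run, hC, ← h]
    rfl

theorem Exec.outputsIn [Fintype K] {p : StackProg K} {i o : K} {w v : List Bool} {t : ℕ}
    {σ : Store K} (H : Exec p (fun k => if k = i then w else []) t σ) (hv : σ o = v) :
    (p.machine i o).OutputsIn w v t := by
  refine ⟨{ state := none, tape := tapes σ }, ?_, rfl, ?_⟩
  · rw [← zero_add t]
    refine H.leads.run_machine (i := i) (o := o) ((p.machine i o).init w) 0 ?_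
    have hk (k : K) : (if k = i then Turing.Tape.mk₁ (w.map some) else Turing.Tape.mk₁ []) =
        Turing.Tape.mk₁ ((if k = i then w else []).map some) := by
      split_ifs <;> rfl
    rw [MultitapeTM.run, MultitapeTM.init]
    congr 2
    exact funext hk
  · rw [← hv]
    rfl

end StackProg

/-! ### Running time bounds and loops over stacks -/

namespace StackProg

variable {K : Type} [DecidableEq K]

/-- The program `p` changes the stacks from `σ` to `σ'` in at most `T` steps. -/
def Within (p : StackProg K) (σ : Store K) (T : ℕ) (σ' : Store K) : Prop :=
  ∃ t ≤ T, Exec p σ t σ'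

namespace Within

theorem mono {p : StackProg K} {σ σ' : Store K} {T T' : ℕ} (h : Within p σ T σ') (hT : T ≤ T') :
    Within p σ T' σ' := by
  obtain ⟨t, ht, H⟩ := h
  exact ⟨t, ht.trans hT, H⟩

theorem congr {p : StackProg K} {σ σ' σ'' : Store K} {T T' : ℕ} (h : Within p σ T σ') (hT : T ≤ T')
    (hσ : σ' = σ'') : Within p σ T' σ'' :=
  hσ ▸ h.mono hT

theorem skip {σ : Store K} : Within skip σ 1 σ := ⟨1, le_rfl, .skip⟩

theorem push {k : K} {b : Bool} {σ : Store K} :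
    Within (push k b) σ 2 (Function.update σ k (b :: σ k)) := ⟨2, le_rfl, .push⟩

theorem pop {k : K} {σ : Store K} : Within (pop k) σ 1 (Function.update σ k (σ k).tail) :=
  ⟨1, le_rfl, .pop⟩

theorem seq {p q : StackProg K} {σ σ' σ'' : Store K} {T T' : ℕ} (h : Within p σ T σ')
    (h' : Within q σ' T' σ'') : Within (seq p q) σ (T + T') σ'' := by
  obtain ⟨t, ht, H⟩ := h
  obtain ⟨t', ht', H'⟩ := h'
  exact ⟨t' + t, by omega, H.seq H'⟩

theorem branch_nil {k : K} {p q r : StackProg K} {σ σ' : Store K} {T : ℕ} (hk : σ k = [])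
    (h : Within p σ T σ') : Within (branch k p q r) σ (T + 1) σ' := by
  obtain ⟨t, ht, H⟩ := h
  exact ⟨t + 1, by omega, H.branch_nil hk⟩

theorem branch_cons {k : K} {p q r : StackProg K} {σ σ' : Store K} {T : ℕ} {b : Bool}
    {l : List Bool} (hk : σ k = b :: l) (h : Within (bif b then r else q) σ T σ') :
    Within (branch k p q r) σ (T + 1) σ' := by
  obtain ⟨t, ht, H⟩ := h
  cases b
  · exact ⟨t + 1, by omega, H.branch_false hk⟩
  · exact ⟨t + 1, by omega, H.branch_true hk⟩

end Within

/-- Pop a bit from the stack `k` (`false` if the stack is empty) and go on depending on this bit. -/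
def popBit (k : K) (f : Bool → StackProg K) : StackProg K :=
  branch k (f false) (seq (pop k) (f false)) (seq (pop k) (f true))

theorem Within.popBit {k : K} {f : Bool → StackProg K} {σ σ' : Store K} {T : ℕ}
    (h : Within (f ((σ k).headD false)) (Function.update σ k (σ k).tail) T σ') :
    Within (popBit k f) σ (T + 2) σ' := by
  cases hk : σ k with
  | nil =>
    rw [hk, List.tail_nil, ← hk, Function.update_eq_self, hk] at h
    exact (Within.branch_nil hk h).mono (by omega)
  | cons b l =>
    rw [hk, List.headD_cons, ← hk] at h
    refine (Within.branch_cons (T := 1 + T) hk ?_).mono (by omega)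
    cases b
    · exact Within.pop.seq h
    · exact Within.pop.seq h

/-- Empty the stack `k`, executing `f b` after each popped bit `b`. -/
def drain (k : K) (f : Bool → StackProg K) : StackProg K :=
  loop k (popBit k f)

theorem Within.drain_nil {k : K} {f : Bool → StackProg K} {σ : Store K} (hk : σ k = []) :
    Within (drain k f) σ 1 σ := ⟨1, le_rfl, .loop_nil hk⟩

theorem Within.drain_cons {k : K} {f : Bool → StackProg K} {σ σ' σ'' : Store K} {T T' : ℕ}
    {b : Bool} {l : List Bool} (hk : σ k = b :: l)
    (h : Within (f b) (Function.update σ k l) T σ') (h' : Within (drain k f) σ' T' σ'') :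
    Within (drain k f) σ (T' + T + 3) σ'' := by
  have h₁ : Within (StackProg.popBit k f) σ (T + 2) σ' := by
    apply Within.popBit
    rwa [hk]
  obtain ⟨t, ht, H⟩ := h₁
  obtain ⟨t', ht', H'⟩ := h'
  exact ⟨t' + t + 1, by omega, .loop_cons hk H H'⟩

/-- A loop whose body takes the stacks from `J i` to `J (i + 1)`, without regard to the stack that
is emptied. -/
theorem Within.drain {k : K} {f : Bool → StackProg K} {T : ℕ} (J : ℕ → Store K) (l : List Bool)
    (h : ∀ i (hi : i < l.length), ∀ l', Within (f l[i]) (Function.update (J i) k l') T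
      (Function.update (J (i + 1)) k l')) {σ σ' : Store K}
    (hσ : Function.update (J 0) k l = σ) (hσ' : Function.update (J l.length) k [] = σ') :
    Within (drain k f) σ (l.length * (T + 3) + 1) σ' := by
  subst hσ hσ'
  induction l generalizing J with
  | nil => exact (Within.drain_nil (by simp)).mono (by simp)
  | cons b l ih =>
    have h₀ := h 0 (by simp) l
    have h₁ := ih (fun i => J (i + 1)) fun i hi l' => by
      exact h (i + 1) (by simpa using hi) l'
    refine (Within.drain_cons (Function.update_self _ _ _) (by simpa using h₀) h₁).mono ?_
    simp only [List.length_cons]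
    linarith

/-- Execute `p` once for each bit of the stack `k`, with the help of the empty stack `j`. -/
def forEach (k j : K) (p : StackProg K) : StackProg K :=
  seq (drain k fun b => seq (push j b) p) (drain j fun b => push k b)

/-- Moving a stack reverses it. -/
theorem Within.move {k j : K} (hkj : j ≠ k) (σ : Store K) :
    Within (StackProg.drain k fun b => StackProg.push j b) σ ((σ k).length * 5 + 1)
      (Function.update (Function.update σ k []) j ((σ k).reverse ++ σ j)) := by
  generalize hl : σ k = l
  induction l generalizing σ with
  | nil =>
    refine (Within.drain_nil hl).congr (by simp) ?_
    rw [← hl, Function.update_eq_self, hl, List.reverse_nil, List.nil_append,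
      Function.update_eq_self]
  | cons b l ih =>
    refine (Within.drain_cons hl Within.push (ih _ ?_)).congr ?_ ?_
    · simp [hkj.symm]
    · simp only [List.length_cons]
      omega
    · funext i
      by_cases hi : i = j
      · subst hi
        simp [hkj]
      · by_cases hi' : i = k
        · simp [hi', hkj.symm]
        · simp [hi, hi']

/-- The bits popped from `k` pile up in reverse on `j`, and moving them back restores `k`. During
the loop both stacks hold parts of `l`, so the body is required to work for any contents `l₁`, `l₂`
of them. Per bit, the body with the push and the test costs `T + 5` and the way back 5. -/
theorem Within.forEach {k j : K} (hkj : j ≠ k) {p : StackProg K} {T : ℕ} (J : ℕ → Store K)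
    (l : List Bool)
    (h : ∀ i < l.length, ∀ l₁ l₂, Within p (Function.update (Function.update (J i) k l₁) j l₂) T
      (Function.update (Function.update (J (i + 1)) k l₁) j l₂)) {σ σ' : Store K}
    (hσ : Function.update (Function.update (J 0) k l) j [] = σ)
    (hσ' : Function.update (Function.update (J l.length) k l) j [] = σ') :
    Within (forEach k j p) σ (l.length * (T + 10) + 2) σ' := by
  have h₁ := Within.drain (k := k) (f := fun b => StackProg.seq (StackProg.push j b) p)
    (T := 2 + T) (fun i => Function.update (J i) j (l.take i).reverse) l (fun i hi l' => by
      refine (Within.push.seq (T' := T) (σ'' := Function.update (Function.update (J (i + 1)) k l') j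
        (l[i] :: (l.take i).reverse)) ?_).congr le_rfl ?_
      · convert h i hi l' (l[i] :: (l.take i).reverse) using 1
        rw [Function.update_comm hkj]
        simp
      · rw [Function.update_comm hkj]
        rw [List.take_succ_eq_append_getElem hi, List.reverse_append]
        rfl) rfl rfl
  subst hσ hσ'
  rw [StackProg.forEach, Function.update_comm hkj.symm]
  refine Within.congr (h₁.seq (Within.move hkj.symm _)) ?_ ?_
  · simp [hkj]
    linarith
  · funext i
    by_cases hi : i = j
    · subst hi
      simp [hkj]
    · by_cases hi' : i = k
      · simp [hi', hkj, hkj.symm]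
      · simp [hi, hi']

end StackProg

/-! ### Binary words, the stacks of the counting program, and reading the input -/

/-- The value of a binary word, least significant digit first. -/
def wordValue : List Bool → ℕ
  | [] => 0
  | b :: l => b.toNat + 2 * wordValue l

namespace StackProg

/-- The stacks of the program that counts partitions. -/
inductive Reg : Type
  | inp
  | out
  | u
  | e
  | d
  | s
  | x
  | y
  | p
  | a
  | w
  | c
  deriving DecidableEq

instance : Fintype Reg where
  elems := {.inp, .out, .u, .e, .d, .s, .x, .y, .p, .a, .w, .c}
  complete k := by cases k <;> decide

/-- The store with the given contents of the stacks. -/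
def store (inp out u e d s x y p a w c : List Bool) : Store Reg
  | .inp => inp
  | .out => out
  | .u => u
  | .e => e
  | .d => d
  | .s => s
  | .x => x
  | .y => y
  | .p => p
  | .a => a
  | .w => w
  | .c => c

section store

variable (inp out u e d s x y p a w c z : List Bool)

@[simp]
theorem update_store_inp : Function.update (store inp out u e d s x y p a w c) .inp z =
    store z out u e d s x y p a w c := by
  funext j; cases j <;> rfl

@[simp]
theorem update_store_out : Function.update (store inp out u e d s x y p a w c) .out z =
    store inp z u e d s x y p a w c := by
  funext j; cases j <;> rfl

@[simp]
theorem update_store_u : Function.update (store inp out u e d s x y p a w c) .u z =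
    store inp out z e d s x y p a w c := by
  funext j; cases j <;> rfl

@[simp]
theorem update_store_e : Function.update (store inp out u e d s x y p a w c) .e z =
    store inp out u z d s x y p a w c := by
  funext j; cases j <;> rfl

@[simp]
theorem update_store_d : Function.update (store inp out u e d s x y p a w c) .d z =
    store inp out u e z s x y p a w c := by
  funext j; cases j <;> rfl

@[simp]
theorem update_store_s : Function.update (store inp out u e d s x y p a w c) .s z =
    store inp out u e d z x y p a w c := by
  funext j; cases j <;> rfl

@[simp]
theorem update_store_x : Function.update (store inp out u e d s x y p a w c) .x z =
    store inp out u e d s z y p a w c := by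
  funext j; cases j <;> rfl

@[simp]
theorem update_store_y : Function.update (store inp out u e d s x y p a w c) .y z =
    store inp out u e d s x z p a w c := by
  funext j; cases j <;> rfl

@[simp]
theorem update_store_p : Function.update (store inp out u e d s x y p a w c) .p z =
    store inp out u e d s x y z a w c := by
  funext j; cases j <;> rfl

@[simp]
theorem update_store_a : Function.update (store inp out u e d s x y p a w c) .a z =
    store inp out u e d s x y p z w c := by
  funext j; cases j <;> rfl

@[simp]
theorem update_store_w : Function.update (store inp out u e d s x y p a w c) .w z =
    store inp out u e d s x y p a z c := by
  funext j; cases j <;> rfl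

@[simp]
theorem update_store_c : Function.update (store inp out u e d s x y p a w c) .c z =
    store inp out u e d s x y p a w z := by
  funext j; cases j <;> rfl

@[simp]
theorem store_inp : store inp out u e d s x y p a w c .inp = inp := rfl

@[simp]
theorem store_out : store inp out u e d s x y p a w c .out = out := rfl

@[simp]
theorem store_u : store inp out u e d s x y p a w c .u = u := rfl

@[simp]
theorem store_e : store inp out u e d s x y p a w c .e = e := rfl

@[simp]
theorem store_d : store inp out u e d s x y p a w c .d = d := rfl

@[simp]
theorem store_s : store inp out u e d s x y p a w c .s = s := rfl

@[simp]
theorem store_x : store inp out u e d s x y p a w c .x = x := rfl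

@[simp]
theorem store_y : store inp out u e d s x y p a w c .y = y := rfl

@[simp]
theorem store_p : store inp out u e d s x y p a w c .p = p := rfl

@[simp]
theorem store_a : store inp out u e d s x y p a w c .a = a := rfl

@[simp]
theorem store_w : store inp out u e d s x y p a w c .w = w := rfl

@[simp]
theorem store_c : store inp out u e d s x y p a w c .c = c := rfl

end store

/-- A word of length `n`. -/
abbrev unary (n : ℕ) : List Bool := List.replicate n false

end StackProg

theorem wordValue_bits (n : ℕ) : wordValue n.bits = n := by
  induction n using Nat.binaryRec' with
  | zero => simp [wordValue]
  | bit b n h ih => rw [Nat.bits_append_bit _ _ h, wordValue, ih, Nat.bit_val]; ring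

theorem wordValue_le_append (l l' : List Bool) : wordValue l' ≤ wordValue (l ++ l') := by
  induction l with
  | nil => simp
  | cons b l ih => simp only [List.cons_append, wordValue]; omega

namespace StackProg

open Reg

/-- Read the input and write it in unary on the stack `u`. -/
def load : StackProg Reg :=
  -- Moving the input to `w` reverses it: the most significant digit is now on top, as Horner's
  -- scheme requires.
  seq (drain inp fun b => push w b)
    (drain w fun b => seq (drain u fun _ => seq (push x false) (push x false))
      (seq (drain x fun _ => push u false) (bif b then push u false else skip)))

/-- One step of Horner's scheme, in unary. -/
theorem within_double (m : ℕ) (b : Bool) (l : List Bool) :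
    Within (seq (drain u fun _ => seq (push x false) (push x false))
      (seq (drain x fun _ => push u false) (bif b then push u false else skip)))
      (store [] [] (unary m) [] [] [] [] [] [] [] l []) (17 * m + 4)
      (store [] [] (unary (b.toNat + 2 * m)) [] [] [] [] [] [] [] l []) := by
  have h₁ : Within (drain u fun _ => seq (push x false) (push x false))
      (store [] [] (unary m) [] [] [] [] [] [] [] l []) (m * 7 + 1)
      (store [] [] [] [] [] [] (unary (2 * m)) [] [] [] l []) := by
    refine (Within.drain (T := 4)
      (fun i => store [] [] [] [] [] [] (unary (2 * i)) [] [] [] l []) (unary m)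
      (fun i _ l' => (Within.push.seq Within.push).congr le_rfl ?_) ?_ ?_).mono ?_
    · simp [Nat.mul_succ, List.replicate_succ]
    · simp
    · simp
    · simp
  have h₂ : Within (drain x fun _ => push u false)
      (store [] [] [] [] [] [] (unary (2 * m)) [] [] [] l []) (2 * m * 5 + 1)
      (store [] [] (unary (2 * m)) [] [] [] [] [] [] [] l []) := by
    refine (Within.drain (f := fun _ => push u false) (T := 2)
      (fun i => store [] [] (unary i) [] [] [] [] [] [] [] l []) (unary (2 * m))
      (fun i _ l' => Within.push.congr le_rfl ?_) ?_ ?_).mono ?_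
    · simp [List.replicate_succ]
    · simp
    · simp
    · simp
  refine (h₁.seq (h₂.seq (T' := 2) ?_)).mono (by omega)
  cases b
  · exact Within.skip.congr (by omega) (by simp)
  · exact Within.push.congr (by omega) (by simp [add_comm 1, List.replicate_succ])

theorem within_load (n : ℕ) :
    Within load (store n.bits [] [] [] [] [] [] [] [] [] [] [])
      (n.bits.length * (17 * n + 12) + 2) (store [] [] (unary n) [] [] [] [] [] [] [] [] []) := by
  have h₁ : Within (drain inp fun b => push w b) (store n.bits [] [] [] [] [] [] [] [] [] [] [])
      (n.bits.length * 5 + 1) (store [] [] [] [] [] [] [] [] [] [] n.bits.reverse []) :=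
    (Within.move (show w ≠ inp by decide) _).congr (by simp) (by simp)
  have h₂ := Within.drain (k := w) (T := 17 * n + 4)
    (σ := store [] [] [] [] [] [] [] [] [] [] n.bits.reverse [])
    (f := fun b => seq (drain u fun _ => seq (push x false) (push x false))
      (seq (drain x fun _ => push u false) (bif b then push u false else skip)))
    (fun i => store [] [] (unary (wordValue (n.bits.reverse.take i).reverse)) [] [] [] [] [] [] []
      [] []) n.bits.reverse (fun i hi l' => by
        rw [List.take_succ_eq_append_getElem hi, List.reverse_append, List.reverse_singleton,
          List.singleton_append, wordValue, update_store_w, update_store_w]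
        refine (within_double _ _ _).mono ?_
        -- Every intermediate value of Horner's scheme is at most `n`, which makes the cost of a
        -- round uniform.
        have := wordValue_le_append (n.bits.reverse.drop i).reverse (n.bits.reverse.take i).reverse
        rw [← List.reverse_append, List.take_append_drop, List.reverse_reverse,
          wordValue_bits] at this
        omega)
      (by simp [wordValue]) rfl
  refine Within.congr (h₁.seq h₂) ?_ ?_
  · simp only [List.length_reverse]
    linarith
  · rw [List.take_length]
    simp [wordValue_bits]

end StackProg

/-! ### Arithmetic of binary words -/

/-- The sum of the words `l` and `l'` and the carry `c`, provided that `l'` is not longer than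
`l`. -/
def addWords : List Bool → List Bool → Bool → List Bool
  | [], _, c => [c]
  | b :: l, l', c =>
      (b ^^ (l'.headD false) ^^ c) ::
        addWords l l'.tail (b && l'.headD false || b && c || l'.headD false && c)

theorem length_addWords (l l' : List Bool) (c : Bool) : (addWords l l' c).length = l.length + 1 := by
  induction l generalizing l' c with
  | nil => rfl
  | cons b l ih => simp [addWords, ih]

theorem wordValue_eq_headD_add (l : List Bool) :
    wordValue l = (l.headD false).toNat + 2 * wordValue l.tail := by
  cases l <;> simp [wordValue]

theorem wordValue_addWords (l l' : List Bool) (c : Bool) (h : l'.length ≤ l.length) :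
    wordValue (addWords l l' c) = wordValue l + wordValue l' + c.toNat := by
  induction l generalizing l' c with
  | nil => simp_all [addWords, wordValue]
  | cons b l ih =>
    rw [addWords, wordValue, ih _ _ (by simpa using h), wordValue_eq_headD_add l', wordValue]
    cases b <;> cases c <;> cases l'.headD false <;> simp <;> ring

/-- The first `n` letters of a word, which is continued by zeros. -/
def firstBits (l : List Bool) (n : ℕ) : List Bool :=
  (List.range n).map (l.getD · false)

theorem length_firstBits (l : List Bool) (n : ℕ) : (firstBits l n).length = n := by
  simp [firstBits]

theorem firstBits_succ (l : List Bool) (n : ℕ) :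
    firstBits l (n + 1) = firstBits l n ++ [(l.drop n).headD false] := by
  rw [firstBits, List.range_succ, List.map_append, List.map_singleton, firstBits]
  simp [List.headD_eq_head?_getD]

theorem firstBits_succ' (l : List Bool) (n : ℕ) :
    firstBits l (n + 1) = l.headD false :: firstBits l.tail n := by
  rw [firstBits, List.range_succ_eq_map, List.map_cons, List.map_map, firstBits]
  cases l <;> simp [Function.comp_def]

theorem wordValue_append (l l' : List Bool) :
    wordValue (l ++ l') = wordValue l + 2 ^ l.length * wordValue l' := by
  induction l with
  | nil => simp [wordValue]
  | cons b l ih =>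
    rw [List.cons_append, wordValue, ih, wordValue, List.length_cons]
    ring

theorem wordValue_firstBits_add (l : List Bool) (n : ℕ) :
    wordValue (firstBits l n) + 2 ^ n * wordValue (l.drop n) = wordValue l := by
  induction n generalizing l with
  | zero => simp [firstBits, wordValue]
  | succ n ih =>
    rw [firstBits_succ', wordValue, wordValue_eq_headD_add l, ← ih l.tail, List.drop_tail]
    ring

theorem wordValue_lt (l : List Bool) : wordValue l < 2 ^ l.length := by
  induction l with
  | nil => simp [wordValue]
  | cons b l ih =>
    have := b.toNat_lt
    rw [wordValue, List.length_cons, pow_succ]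
    omega

theorem wordValue_drop (l : List Bool) (n : ℕ) : wordValue (l.drop n) = wordValue l / 2 ^ n := by
  have := wordValue_lt (firstBits l n)
  rw [length_firstBits] at this
  rw [← wordValue_firstBits_add l n, Nat.add_mul_div_left _ _ (by positivity),
    Nat.div_eq_of_lt this, zero_add]

theorem wordValue_firstBits (l : List Bool) (n : ℕ) :
    wordValue (firstBits l n) = wordValue l % 2 ^ n := by
  have := wordValue_lt (firstBits l n)
  rw [length_firstBits] at this
  rw [← wordValue_firstBits_add l n, Nat.add_mul_mod_self_left, Nat.mod_eq_of_lt this]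

/-- The word for `(1 + 2 ^ n) * m`, where `m` is the value of `l`. -/
def addShift (l : List Bool) (n : ℕ) : List Bool :=
  firstBits l n ++ addWords l (l.drop n) false

theorem length_addShift (l : List Bool) (n : ℕ) : (addShift l n).length = n + l.length + 1 := by
  simp [addShift, length_firstBits, length_addWords, add_assoc]

/-- In `m + 2 ^ n * m` the low `n` digits are those of `m`; above them `m` is added to its own
remaining digits, which form a word not longer than `l`. -/
theorem wordValue_addShift (l : List Bool) (n : ℕ) :
    wordValue (addShift l n) = wordValue l * (1 + 2 ^ n) := by
  rw [addShift, wordValue_append, wordValue_addWords _ _ _ (by simp), length_firstBits,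
    Bool.toNat_false]
  linarith [wordValue_firstBits_add l n]

/-- Remove leading zeros. -/
def trimZeros : List Bool → List Bool
  | [] => []
  | b :: l => if b = true ∨ trimZeros l ≠ [] then b :: trimZeros l else []

theorem trimZeros_eq_bits (l : List Bool) : trimZeros l = (wordValue l).bits := by
  induction l with
  | nil => simp [trimZeros, wordValue]
  | cons b l ih =>
    have h0 : (wordValue l).bits = [] ↔ wordValue l = 0 := by
      refine ⟨fun h => ?_, fun h => by simp [h]⟩
      rw [← wordValue_bits (wordValue l), h, wordValue]
    rw [trimZeros, ih, wordValue]
    split_ifs with h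
    · rw [add_comm, ← Nat.bit_val, Nat.bits_append_bit]
      intro hl
      simpa [hl] using h
    · push Not at h
      have hb : b = false := by simpa using h.1
      simp [hb, h0.1 h.2]

/-! ### The program for the product and its running time -/

namespace StackProg

open Reg

/-- Initialize the stacks: the first factor is the word of value `1`. -/
def setup : StackProg Reg :=
  seq (forEach u x (seq (push e false) (push d false)))
    (seq (push e false) (seq (push d false) (push p true)))

theorem within_setup (n : ℕ) :
    Within setup (store [] [] (unary n) [] [] [] [] [] [] [] [] []) (n * 14 + 8)
      (store [] [] (unary n) (unary (n + 1)) (unary (n + 1)) [] [] [] [true] [] [] []) := by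
  have h : Within (forEach u x (seq (push e false) (push d false)))
      (store [] [] (unary n) [] [] [] [] [] [] [] [] []) (n * 14 + 2)
      (store [] [] (unary n) (unary n) (unary n) [] [] [] [] [] [] []) := by
    refine (Within.forEach (by decide) (T := 4)
      (fun i => store [] [] [] (unary i) (unary i) [] [] [] [] [] [] []) (unary n)
      (fun i _ l₁ l₂ => (Within.push.seq Within.push).congr le_rfl ?_) ?_ ?_).mono ?_
    · simp [List.replicate_succ]
    · simp
    · simp
    · simp
  exact (h.seq (Within.push.seq (Within.push.seq Within.push))).congr (by omega)
    (by simp [List.replicate_succ])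

/-- Advance the unary counters `s` and `d`. -/
def advance : StackProg Reg :=
  seq (forEach d y (push s false)) (forEach e y (seq (push d false) (push d false)))

/-- Successive squares by differences: with `B` on `e`, `B * (2 * i + 1)` on `d` and `B * i ^ 2` on
`s`, this passes from `i` to `i + 1` without a multiplication. -/
theorem within_advance (u₀ x₀ l : List Bool) (ε δ a : ℕ) :
    Within advance (store [] [] u₀ (unary ε) (unary δ) (unary a) x₀ [] l [] [] [])
      (δ * 12 + ε * 14 + 4)
      (store [] [] u₀ (unary ε) (unary (δ + 2 * ε)) (unary (a + δ)) x₀ [] l [] [] []) := by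
  have h₁ : Within (forEach d y (push s false))
      (store [] [] u₀ (unary ε) (unary δ) (unary a) x₀ [] l [] [] []) (δ * 12 + 2)
      (store [] [] u₀ (unary ε) (unary δ) (unary (a + δ)) x₀ [] l [] [] []) := by
    refine (Within.forEach (by decide) (T := 2)
      (fun i => store [] [] u₀ (unary ε) [] (unary (a + i)) x₀ [] l [] [] []) (unary δ)
      (fun i _ l₁ l₂ => Within.push.congr le_rfl ?_) ?_ ?_).mono ?_
    · simp [← add_assoc, List.replicate_succ]
    · simp
    · simp
    · simp
  have h₂ : Within (forEach e y (seq (push d false) (push d false)))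
      (store [] [] u₀ (unary ε) (unary δ) (unary (a + δ)) x₀ [] l [] [] []) (ε * 14 + 2)
      (store [] [] u₀ (unary ε) (unary (δ + 2 * ε)) (unary (a + δ)) x₀ [] l [] [] []) := by
    refine (Within.forEach (by decide) (T := 4)
      (fun i => store [] [] u₀ [] (unary (δ + 2 * i)) (unary (a + δ)) x₀ [] l [] [] []) (unary ε)
      (fun i _ l₁ l₂ => (Within.push.seq Within.push).congr le_rfl ?_) ?_ ?_).mono ?_
    · simp [Nat.mul_succ, ← add_assoc, List.replicate_succ]
    · simp
    · simp
    · simp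
  exact (h₁.seq h₂).mono (by omega)

/-- Add up the stacks `a` and `p` and the carry on the stack `c`. -/
def addLoop : StackProg Reg :=
  drain a fun b => popBit p fun b' => popBit c fun b'' =>
    seq (push w (b ^^ b' ^^ b'')) (push c (b && b' || b && b'' || b' && b''))

theorem within_addLoop (u₀ e₀ d₀ s₀ x₀ l l' r : List Bool) (b : Bool) :
    Within (seq addLoop (drain c fun b => push w b))
      (store [] [] u₀ e₀ d₀ s₀ x₀ [] l' l r [b]) (l.length * 11 + 7)
      (store [] [] u₀ e₀ d₀ s₀ x₀ [] (l'.drop l.length) [] ((addWords l l' b).reverse ++ r) []) := by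
  -- The last carry `b'` is the leading digit of the sum; it is still on `c` when the loop ends.
  have h : ∃ b' r', b' :: r' = (addWords l l' b).reverse ++ r ∧ Within addLoop
      (store [] [] u₀ e₀ d₀ s₀ x₀ [] l' l r [b]) (l.length * 11 + 1)
      (store [] [] u₀ e₀ d₀ s₀ x₀ [] (l'.drop l.length) [] r' [b']) := by
    induction l generalizing l' r b with
    | nil => exact ⟨b, r, by simp [addWords], (Within.drain_nil rfl).mono (by simp)⟩
    | cons b₁ l ih =>
      obtain ⟨b', r', hr, ih⟩ := ih l'.tail ((b₁ ^^ (l'.headD false) ^^ b) :: r)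
        (b₁ && l'.headD false || b₁ && b || l'.headD false && b)
      refine ⟨b', r', by simpa [addWords] using hr, ?_⟩
      rw [addLoop] at ih ⊢
      refine Within.congr (Within.drain_cons (T := 8)
        (σ := store [] [] u₀ e₀ d₀ s₀ x₀ [] l' (b₁ :: l) r [b]) (b := b₁) (l := l) rfl ?_ ih) ?_ ?_
      · refine Within.popBit (T := 6) (Within.popBit (T := 4)
          (Within.congr (Within.push.seq Within.push) le_rfl ?_))
        simp
      · simp only [List.length_cons]
        omega
      · simp
  obtain ⟨b', r', hr, h⟩ := h
  refine Within.congr (h.seq (Within.move (by decide) _)) ?_ ?_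
  · simp
  · simp [hr]

/-- Multiply the value of `p` by `1 + 2 ^ k`, where `k` is the length of `s`. -/
def multiply : StackProg Reg :=
  seq (drain p fun b => push w b)
    (seq (drain w fun b => seq (push p b) (push a b))
      (seq (forEach s y (popBit p fun b => push w b))
        (seq (push c false)
          (seq (seq addLoop (drain c fun b => push w b)) (drain w fun b => push p b)))))

/-- The word is duplicated on `p` and `a`. The low `k` digits of the copy on `p` go straight to `w`,
and the rest of it is added to the whole copy on `a`; `w` collects the result in reverse. -/
theorem within_multiply (u₀ e₀ d₀ x₀ l : List Bool) (k : ℕ) :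
    Within multiply (store [] [] u₀ e₀ d₀ (unary k) x₀ [] l [] [] [])
      (l.length * 28 + k * 19 + 20)
      (store [] [] u₀ e₀ d₀ (unary k) x₀ [] (addShift l k) [] [] []) := by
  have h₁ : Within (drain p fun b => push w b)
      (store [] [] u₀ e₀ d₀ (unary k) x₀ [] l [] [] []) (l.length * 5 + 1)
      (store [] [] u₀ e₀ d₀ (unary k) x₀ [] [] [] l.reverse []) :=
    (Within.move (by decide) _).congr (by simp) (by simp)
  have h₂ : Within (drain w fun b => seq (push p b) (push a b))
      (store [] [] u₀ e₀ d₀ (unary k) x₀ [] [] [] l.reverse []) (l.length * 7 + 1)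
      (store [] [] u₀ e₀ d₀ (unary k) x₀ [] l l [] []) := by
    refine (Within.drain (T := 4) (f := fun b => seq (push p b) (push a b))
      (fun i => store [] [] u₀ e₀ d₀ (unary k) x₀ [] (l.reverse.take i).reverse
        (l.reverse.take i).reverse [] []) l.reverse
      (fun i hi l' => (Within.push.seq Within.push).congr le_rfl ?_) ?_ ?_).mono ?_
    · rw [List.take_succ_eq_append_getElem hi, List.reverse_append]
      simp
    · simp
    · rw [List.take_length]
      simp
    · simp
  have h₃ : Within (forEach s y (popBit p fun b => push w b))
      (store [] [] u₀ e₀ d₀ (unary k) x₀ [] l l [] []) (k * 14 + 2)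
      (store [] [] u₀ e₀ d₀ (unary k) x₀ [] (l.drop k) l (firstBits l k).reverse []) := by
    refine (Within.forEach (by decide) (T := 4)
      (fun i => store [] [] u₀ e₀ d₀ [] x₀ [] (l.drop i) l (firstBits l i).reverse []) (unary k)
      (fun i _ l₁ l₂ => Within.popBit (T := 2) (Within.push.congr le_rfl ?_)) ?_ ?_).mono ?_
    · simp [firstBits_succ]
    · simp [firstBits]
    · simp
    · simp
  have h₄ := within_addLoop u₀ e₀ d₀ (unary k) x₀ l (l.drop k) (firstBits l k).reverse false
  have h₅ : Within (drain w fun b => push p b)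
      (store [] [] u₀ e₀ d₀ (unary k) x₀ [] [] [] (addShift l k).reverse [])
      ((k + l.length + 1) * 5 + 1)
      (store [] [] u₀ e₀ d₀ (unary k) x₀ [] (addShift l k) [] [] []) :=
    (Within.move (by decide) _).congr (by simp [length_addShift]) (by simp)
  rw [← List.reverse_append, ← addShift,
    show (l.drop k).drop l.length = [] by simp] at h₄
  have h₆ : Within (push c false)
      (store [] [] u₀ e₀ d₀ (unary k) x₀ [] (l.drop k) l (firstBits l k).reverse []) 2
      (store [] [] u₀ e₀ d₀ (unary k) x₀ [] (l.drop k) l (firstBits l k).reverse [false]) :=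
    Within.push.congr le_rfl (by simp)
  exact (h₁.seq (h₂.seq (h₃.seq (h₆.seq (h₄.seq h₅))))).mono (by omega)

end StackProg

/-- The word for the product of the numbers `1 + 2 ^ (B * j ^ 2)` with `1 ≤ j ≤ k`. -/
def squaresProduct (B : ℕ) : ℕ → List Bool
  | 0 => [true]
  | k + 1 => addShift (squaresProduct B k) (B * (k + 1) ^ 2)

theorem wordValue_squaresProduct (B k : ℕ) :
    wordValue (squaresProduct B k) = ∏ j ∈ Finset.Icc 1 k, (1 + 2 ^ (B * j ^ 2)) := by
  induction k with
  | zero => simp [squaresProduct, wordValue]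
  | succ k ih => rw [squaresProduct, wordValue_addShift, ih, Finset.prod_Icc_succ_top (by omega)]

theorem length_squaresProduct_le (B n k : ℕ) (h : k ≤ n) :
    (squaresProduct B k).length ≤ 1 + k * (B * n ^ 2 + 1) := by
  induction k with
  | zero => simp [squaresProduct]
  | succ k ih =>
    have h₁ : B * (k + 1) ^ 2 ≤ B * n ^ 2 := by gcongr
    rw [squaresProduct, length_addShift, Nat.succ_mul]
    have := ih (by omega)
    omega

namespace StackProg

open Reg

/-- Compute the product of the numbers `1 + 2 ^ (B * j ^ 2)`. -/
def multiplyAll : StackProg Reg :=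
  forEach u x (seq advance multiply)

theorem within_multiplyAll (n : ℕ) :
    Within multiplyAll
      (store [] [] (unary n) (unary (n + 1)) (unary (n + 1)) [] [] [] [true] [] [] [])
      (n * (109 * (n + 1) ^ 4 + 10) + 2)
      (store [] [] (unary n) (unary (n + 1)) (unary ((n + 1) * (2 * n + 1)))
        (unary ((n + 1) * n ^ 2)) [] [] (squaresProduct (n + 1) n) [] [] []) := by
  refine (Within.forEach (by decide) (T := 109 * (n + 1) ^ 4)
    (fun i => store [] [] [] (unary (n + 1)) (unary ((n + 1) * (2 * i + 1)))
        (unary ((n + 1) * i ^ 2)) [] [] (squaresProduct (n + 1) i) [] [] []) (unary n)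
    (fun i hi l₁ l₂ => ?_) ?_ ?_).mono ?_
  · simp only [update_store_u, update_store_x]
    have h₁ := within_advance l₁ l₂ (squaresProduct (n + 1) i) (n + 1) ((n + 1) * (2 * i + 1))
      ((n + 1) * i ^ 2)
    rw [show (n + 1) * (2 * i + 1) + 2 * (n + 1) = (n + 1) * (2 * (i + 1) + 1) by ring,
      show (n + 1) * i ^ 2 + (n + 1) * (2 * i + 1) = (n + 1) * (i + 1) ^ 2 by ring] at h₁
    refine (h₁.seq (within_multiply _ _ _ _ _ _)).mono ?_
    have hi : i + 1 ≤ n := by simpa using hi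
    -- All quantities are compared with `(n + 1) ^ 4`; the constant is `109 = 12 * 2 + 14 + 4 + 28 +
    -- 19 + 20`.
    have h₂ : (n + 1) * (2 * i + 1) ≤ 2 * (n + 1) ^ 4 := by
      calc (n + 1) * (2 * i + 1) ≤ (n + 1) * (2 * (n + 1)) := by gcongr; omega
        _ = 2 * (n + 1) ^ 2 := by ring
        _ ≤ 2 * (n + 1) ^ 4 := by gcongr <;> omega
    have h₃ : n + 1 ≤ (n + 1) ^ 4 := Nat.le_self_pow (by norm_num) _
    have h₄ : (n + 1) * (i + 1) ^ 2 ≤ (n + 1) ^ 4 := by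
      calc (n + 1) * (i + 1) ^ 2 ≤ (n + 1) * (n + 1) ^ 2 := by gcongr; omega
        _ = (n + 1) ^ 3 := by ring
        _ ≤ (n + 1) ^ 4 := by gcongr <;> omega
    have h₅ : (squaresProduct (n + 1) i).length ≤ (n + 1) ^ 4 := by
      calc (squaresProduct (n + 1) i).length ≤ 1 + i * ((n + 1) * n ^ 2 + 1) :=
            length_squaresProduct_le _ _ _ (by omega)
        _ ≤ 1 + n * ((n + 1) * n ^ 2 + 1) := by gcongr; omega
        _ ≤ (n + 1) ^ 4 := by ring_nf; nlinarith
    have h₆ : 1 ≤ (n + 1) ^ 4 := Nat.one_le_pow _ _ (by omega)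
    omega
  · simp [squaresProduct]
  · simp
  · simp

/-- Output the block number `n` of the word on the stack `p`; the blocks have length `n + 1`. -/
def extract : StackProg Reg :=
  seq (forEach u x (forEach e y (pop p)))
    (seq (drain e fun _ => popBit p fun b => push w b)
      -- The most significant digit is on top of `w`; a zero is dropped as long as `out` is empty,
      -- so that the output has no leading zeros.
      (seq (drain w fun b => branch out (bif b then push out b else skip) (push out b) (push out b))
        -- The sign bit of a nonnegative integer.
        (push out false)))

theorem within_trim (e₀ d₀ s₀ p₀ u₀ l : List Bool) :
    Within (drain w fun b => branch out (bif b then push out b else skip) (push out b) (push out b))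
      (store [] [] u₀ e₀ d₀ s₀ [] [] p₀ [] l.reverse []) (l.length * 6 + 1)
      (store [] (trimZeros l) u₀ e₀ d₀ s₀ [] [] p₀ [] [] []) := by
  refine (Within.drain (k := w) (T := 3)
    (f := fun b => branch out (bif b then push out b else skip) (push out b) (push out b))
    (fun i => store [] (trimZeros (l.reverse.take i).reverse) u₀ e₀ d₀ s₀ [] [] p₀ [] [] [])
    l.reverse (fun i hi l' => ?_) ?_ ?_).mono ?_
  · rw [List.take_succ_eq_append_getElem hi, List.reverse_append, List.reverse_singleton,
      List.singleton_append, trimZeros]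
    generalize l.reverse[i] = b
    generalize trimZeros (l.reverse.take i).reverse = m
    simp only [update_store_w]
    cases m with
    | nil =>
      refine Within.branch_nil (T := 2) rfl ?_
      cases b
      · exact Within.skip.congr (by omega) (by simp)
      · exact Within.push.congr le_rfl (by simp)
    | cons b' m =>
      refine Within.branch_cons (T := 2) rfl ?_
      cases b' <;> exact Within.push.congr le_rfl (by simp)
  · simp [trimZeros]
  · rw [List.take_length]
    simp
  · simp

theorem within_extract (n : ℕ) (d₀ s₀ l : List Bool) :
    Within extract (store [] [] (unary n) (unary (n + 1)) d₀ s₀ [] [] l [] [] [])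
      (n * ((n + 1) * 11 + 12) + (n + 1) * 13 + 6)
      (store [] (false :: (wordValue l / 2 ^ ((n + 1) * n) % 2 ^ (n + 1)).bits) (unary n) [] d₀ s₀
        [] [] (l.drop ((n + 1) * n + (n + 1))) [] [] []) := by
  have h₁ : Within (forEach u x (forEach e y (pop p)))
      (store [] [] (unary n) (unary (n + 1)) d₀ s₀ [] [] l [] [] [])
      (n * ((n + 1) * 11 + 12) + 2)
      (store [] [] (unary n) (unary (n + 1)) d₀ s₀ [] [] (l.drop ((n + 1) * n)) [] [] []) := by
    refine (Within.forEach (by decide) (T := (n + 1) * 11 + 2)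
      (fun i => store [] [] [] (unary (n + 1)) d₀ s₀ [] [] (l.drop ((n + 1) * i)) [] [] [])
      (unary n) (fun i hi l₁ l₂ => ?_) ?_ ?_).mono ?_
    · refine (Within.forEach (by decide) (T := 1)
        (fun j => store [] [] l₁ [] d₀ s₀ l₂ [] (l.drop ((n + 1) * i + j)) [] [] [])
        (unary (n + 1)) (fun j _ l₃ l₄ => Within.pop.congr le_rfl ?_) ?_ ?_).mono ?_
      · simp [add_assoc]
      · simp
      · simp [Nat.mul_succ]
      · simp
    · simp
    · simp
    · simp
  have h₂ : Within (drain e fun _ => popBit p fun b => push w b)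
      (store [] [] (unary n) (unary (n + 1)) d₀ s₀ [] [] (l.drop ((n + 1) * n)) [] [] [])
      ((n + 1) * 7 + 1)
      (store [] [] (unary n) [] d₀ s₀ [] [] (l.drop ((n + 1) * n + (n + 1))) []
        (firstBits (l.drop ((n + 1) * n)) (n + 1)).reverse []) := by
    refine (Within.drain (k := e) (T := 4) (f := fun _ => popBit p fun b => push w b)
      (fun i => store [] [] (unary n) [] d₀ s₀ [] [] (l.drop ((n + 1) * n + i)) []
        (firstBits (l.drop ((n + 1) * n)) i).reverse []) (unary (n + 1))
      (fun i hi l' => Within.popBit (T := 2) (Within.push.congr le_rfl ?_)) ?_ ?_).mono ?_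
    · simp [firstBits_succ, add_assoc]
    · simp [firstBits]
    · simp
    · simp
  have h₃ := within_trim [] d₀ s₀ (l.drop ((n + 1) * n + (n + 1))) (unary n)
    (firstBits (l.drop ((n + 1) * n)) (n + 1))
  rw [trimZeros_eq_bits, wordValue_firstBits, wordValue_drop, length_firstBits] at h₃
  exact (h₁.seq (h₂.seq (h₃.seq Within.push))).congr (by omega) (by simp)

/-- Read `n`, compute the product of the numbers `1 + 2 ^ ((n + 1) * j ^ 2)` for `j ≤ n`, and
output one block of its binary digits. -/
def countSquares : StackProg Reg :=
  seq load (seq setup (seq multiplyAll extract))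

theorem within_countSquares (n : ℕ) : ∃ σ : Store Reg,
    Within countSquares (store n.bits [] [] [] [] [] [] [] [] [] [] []) (300 * (n + 1) ^ 5) σ ∧
      σ out = false ::
        ((∏ j ∈ Finset.Icc 1 n, (1 + 2 ^ ((n + 1) * j ^ 2))) / 2 ^ ((n + 1) * n) %
          2 ^ (n + 1)).bits := by
  refine ⟨_, ((within_load n).seq ((within_setup n).seq ((within_multiplyAll n).seq
    (within_extract n _ _ _)))).mono ?_, ?_⟩
  · have h : n.bits.length ≤ n := by
      rw [Nat.size_eq_bits_len]
      exact Nat.size_le.2 Nat.lt_two_pow_self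
    calc _ ≤ n * (17 * n + 12) + 2 + (n * 14 + 8 + (n * (109 * (n + 1) ^ 4 + 10) + 2 +
        (n * ((n + 1) * 11 + 12) + (n + 1) * 13 + 6))) := by gcongr
      _ ≤ _ := by ring_nf; omega
  · rw [store_out, wordValue_squaresProduct]

end StackProg

open StackProg in
theorem exists_machine_countSquares : ∃ M : MultitapeTM, ∀ n : ℕ, ∃ t ≤ 300 * (n + 1) ^ 5,
    M.OutputsIn n.bits (false ::
      ((∏ j ∈ Finset.Icc 1 n, (1 + 2 ^ ((n + 1) * j ^ 2))) / 2 ^ ((n + 1) * n) %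
        2 ^ (n + 1)).bits) t := by
  refine ⟨countSquares.machine .inp .out, fun n => ?_⟩
  obtain ⟨σ, ⟨t, ht, h⟩, hσ⟩ := within_countSquares n
  refine ⟨t, ht, Exec.outputsIn ?_ hσ⟩
  convert h using 1
  funext k
  cases k <;> rfl

/-! ### Partitions as sets of positive integers -/

/-- Finite sets of positive integers whose squares have the sum `n`. -/
abbrev SquareSet (n : ℕ) : Type :=
  {S : Finset ℕ // 0 ∉ S ∧ ∑ i ∈ S, i ^ 2 = n}

/-- The partition with the parts `i ^ 2` for `i` in the given set. -/
def SquareSet.toPartition {n : ℕ} (S : SquareSet n) : n.Partition where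
  parts := S.1.val.map (· ^ 2)
  parts_pos := by
    intro i hi
    obtain ⟨j, hj, rfl⟩ := Multiset.mem_map.1 hi
    exact pow_pos (Nat.pos_of_ne_zero (ne_of_mem_of_not_mem hj S.2.1)) 2
  parts_sum := S.2.2

theorem distinctSquarePartitions_eq (n : ℕ) :
    distinctSquarePartitions n = Nat.card (SquareSet n) := by
  symm
  refine Nat.card_congr (Equiv.ofBijective (fun S => ⟨S.toPartition, ?_, ?_⟩) ⟨?_, ?_⟩)
  · exact S.1.nodup.map (Nat.pow_left_injective two_ne_zero)
  · intro i hi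
    obtain ⟨j, _, rfl⟩ := Multiset.mem_map.1 hi
    exact IsSquare.sq j
  · intro S S' h
    have h := congrArg (fun p => p.1.parts) h
    exact Subtype.ext (Finset.val_injective
      (Multiset.map_injective (Nat.pow_left_injective two_ne_zero) h))
  · rintro ⟨p, hp, hsq⟩
    have hmap : (p.parts.map Nat.sqrt).map (· ^ 2) = p.parts := by
      rw [Multiset.map_map]
      conv_rhs => rw [← Multiset.map_id p.parts]
      refine Multiset.map_congr rfl fun i hi => ?_
      obtain ⟨j, rfl⟩ := hsq i hi
      simp [sq]
    have hnd : (p.parts.map Nat.sqrt).Nodup := by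
      refine Multiset.Nodup.of_map (· ^ 2) ?_
      rwa [hmap]
    refine ⟨⟨⟨p.parts.map Nat.sqrt, hnd⟩, ?_, ?_⟩, ?_⟩
    · intro h0
      obtain ⟨i, hi, h⟩ : ∃ i ∈ p.parts, Nat.sqrt i = 0 := Multiset.mem_map.1 h0
      have := p.parts_pos hi
      rw [Nat.sqrt_eq_zero.1 h] at this
      exact lt_irrefl 0 this
    · rw [Finset.sum, hmap, p.parts_sum]
    · exact Subtype.ext (Nat.Partition.ext hmap)

theorem count_sum_replicate (S : Finset ℕ) (i : ℕ) :
    (∑ j ∈ S, Multiset.replicate j j).count i = if i ∈ S then i else 0 := by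
  rw [Multiset.count_sum']
  simp [Multiset.count_replicate]

/-- The partition with `i` parts `i` for `i` in the given set. -/
def SquareSet.toSelfPartition {n : ℕ} (S : SquareSet n) : n.Partition where
  parts := ∑ i ∈ S.1, Multiset.replicate i i
  parts_pos := by
    intro i hi
    obtain ⟨j, hj, hi⟩ := Multiset.mem_sum.1 hi
    rw [Multiset.eq_of_mem_replicate hi]
    exact Nat.pos_of_ne_zero (ne_of_mem_of_not_mem hj S.2.1)
  parts_sum := by
    rw [Multiset.sum_sum]
    refine Eq.trans ?_ S.2.2
    exact Finset.sum_congr rfl fun i _ => by simp [sq]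

theorem selfMultiplicityPartitions_eq (n : ℕ) :
    selfMultiplicityPartitions n = Nat.card (SquareSet n) := by
  symm
  refine Nat.card_congr (Equiv.ofBijective (fun S => ⟨S.toSelfPartition, ?_⟩) ⟨?_, ?_⟩)
  · intro i _
    rw [SquareSet.toSelfPartition, count_sum_replicate]
    split_ifs <;> simp
  · intro S S' h
    have h (i : ℕ) := congrArg (fun p => p.1.parts.count i) h
    simp only [SquareSet.toSelfPartition, count_sum_replicate] at h
    refine Subtype.ext (Finset.ext fun i => ?_)
    -- Multiplicities cannot detect whether 0 is a member, because it would contribute no parts.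
    rcases eq_or_ne i 0 with rfl | hi
    · simp [S.2.1, S'.2.1]
    · have := h i
      split_ifs at this <;> simp_all
  · rintro ⟨p, hp⟩
    have hmem {i : ℕ} (hi : i ∈ p.parts) : p.parts.count i = i :=
      (hp i (p.parts_pos hi)).resolve_left (Multiset.count_ne_zero.2 hi)
    have hparts : ∑ i ∈ p.parts.toFinset, Multiset.replicate i i = p.parts := by
      ext i
      rw [count_sum_replicate]
      split_ifs with h <;> rw [Multiset.mem_toFinset] at h
      · exact (hmem h).symm
      · exact (Multiset.count_eq_zero.2 h).symm
    refine ⟨⟨p.parts.toFinset, ?_, ?_⟩, Subtype.ext (Nat.Partition.ext hparts)⟩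
    · intro h
      exact lt_irrefl 0 (p.parts_pos (Multiset.mem_toFinset.1 h))
    · conv_rhs => rw [← p.parts_sum, ← hparts, Multiset.sum_sum]
      exact Finset.sum_congr rfl fun i _ => by simp [sq]

theorem SquareSet.subset_Icc {n : ℕ} (S : SquareSet n) : S.1 ⊆ Finset.Icc 1 n := by
  intro i hi
  refine Finset.mem_Icc.2 ⟨Nat.pos_of_ne_zero (ne_of_mem_of_not_mem hi S.2.1), ?_⟩
  calc i ≤ i ^ 2 := Nat.le_self_pow two_ne_zero i
    _ ≤ ∑ i ∈ S.1, i ^ 2 := Finset.single_le_sum (f := fun i => i ^ 2) (fun _ _ => Nat.zero_le _) hi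
    _ = n := S.2.2

theorem card_squareSet (n : ℕ) : Nat.card (SquareSet n) =
    ((Finset.Icc 1 n).powerset.filter fun S => ∑ i ∈ S, i ^ 2 = n).card := by
  refine Nat.subtype_card _ fun S => ?_
  rw [Finset.mem_filter, Finset.mem_powerset]
  refine ⟨fun h => ⟨fun h0 => ?_, h.2⟩, fun h => ⟨SquareSet.subset_Icc ⟨S, h⟩, h.2⟩⟩
  simpa using h.1 h0

instance (n : ℕ) : Finite (SquareSet n) :=
  Finite.of_injective
    (fun S : SquareSet n => (⟨S.1, Finset.mem_powerset.2 S.subset_Icc⟩ :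
      (Finset.Icc 1 n).powerset))
    fun _ _ h => Subtype.ext (Subtype.mk.inj h)

/-! ### Kronecker substitution -/

/-- A digit of a sum of few powers of the base counts how often this power occurs. -/
theorem sum_pow_div_mod {ι : Type*} (F : Finset ι) (g : ι → ℕ) (B n : ℕ) (hF : F.card < 2 ^ B) :
    (∑ t ∈ F, 2 ^ (B * g t)) / 2 ^ (B * n) % 2 ^ B = (F.filter fun t => g t = n).card := by
  -- For positive `n` these are fewer than `2 ^ B` terms, each at most `2 ^ (B * (n - 1))`: no carry
  -- reaches block `n`.
  have hlow : ∑ t ∈ F with g t < n, 2 ^ (B * g t) < 2 ^ (B * n) := by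
    cases n with
    | zero => simp
    | succ n =>
      calc ∑ t ∈ F with g t < n + 1, 2 ^ (B * g t)
          ≤ (F.filter fun t => g t < n + 1).card * 2 ^ (B * n) := by
            rw [← smul_eq_mul]
            refine Finset.sum_le_card_nsmul _ _ _ fun t ht => ?_
            have := (Finset.mem_filter.1 ht).2
            gcongr
            · norm_num
            · omega
        _ ≤ F.card * 2 ^ (B * n) := by gcongr; exact Finset.filter_subset _ _
        _ < 2 ^ B * 2 ^ (B * n) := by gcongr
        _ = 2 ^ (B * (n + 1)) := by rw [← pow_add]; ring
  have hhigh : ∑ t ∈ F with ¬ g t < n, 2 ^ (B * g t) =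
      2 ^ (B * n) * ((F.filter fun t => g t = n).card +
        2 ^ B * ∑ t ∈ F with n < g t, 2 ^ (B * (g t - (n + 1)))) := by
    rw [Finset.card_filter, Finset.sum_filter, Finset.sum_filter, Finset.mul_sum,
      ← Finset.sum_add_distrib, Finset.mul_sum]
    refine Finset.sum_congr rfl fun t _ => ?_
    rcases lt_trichotomy (g t) n with h | h | h
    · simp [h, h.ne, h.not_gt]
    · simp [h]
    · obtain ⟨k, hk⟩ := Nat.exists_eq_add_of_lt h
      simp only [h.not_gt, not_false_eq_true, if_true, h.ne', if_false, h, zero_add, ← pow_add]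
      congr 1
      rw [hk, show n + k + 1 - (n + 1) = k by omega]
      ring
  rw [← Finset.sum_filter_add_sum_filter_not F (fun t => g t < n), hhigh,
    Nat.add_mul_div_left _ _ (by positivity), Nat.div_eq_of_lt hlow, zero_add,
    Nat.add_mul_mod_self_left, Nat.mod_eq_of_lt]
  exact (Finset.card_filter_le _ _).trans_lt hF

/-- Expanding the product gives one power of `2 ^ (n + 1)` for each subset of `Finset.Icc 1 n`, with
the sum of squares as exponent. There are `2 ^ n < 2 ^ (n + 1)` subsets, so blocks of `n + 1` digits
suffice. -/
theorem prod_div_mod (n : ℕ) :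
    (∏ j ∈ Finset.Icc 1 n, (1 + 2 ^ ((n + 1) * j ^ 2))) / 2 ^ ((n + 1) * n) % 2 ^ (n + 1) =
      Nat.card (SquareSet n) := by
  rw [card_squareSet, ← sum_pow_div_mod _ _ (n + 1) n, Finset.prod_one_add]
  · congr 2
    refine Finset.sum_congr rfl fun S _ => ?_
    rw [Finset.prod_pow_eq_pow_sum, Finset.mul_sum]
  · rw [Finset.card_powerset, Nat.card_Icc]
    exact Nat.pow_lt_pow_right (by norm_num) (by omega)

/-! ### Which integers are sums of distinct squares -/

/-- The binary digits of this number tell which numbers are sums of squares of distinct members of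
a list. -/
def squareSumMask : List ℕ → ℕ
  | [] => 1
  | k :: l => squareSumMask l ||| squareSumMask l <<< k ^ 2

theorem testBit_squareSumMask {l : List ℕ} (hl : l.Nodup) (n : ℕ) :
    (squareSumMask l).testBit n = true ↔ ∃ S ⊆ l.toFinset, ∑ i ∈ S, i ^ 2 = n := by
  induction l generalizing n with
  | nil =>
    rw [squareSumMask, Nat.testBit_one_eq_true_iff_self_eq_zero, List.toFinset_nil]
    simp [Finset.subset_empty, eq_comm]
  | cons k l ih =>
    obtain ⟨hk, hl⟩ := List.nodup_cons.1 hl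
    rw [squareSumMask, Nat.testBit_or, Nat.testBit_shiftLeft, Bool.or_eq_true, Bool.and_eq_true,
      ih hl, ih hl, List.toFinset_cons, decide_eq_true_eq]
    constructor
    · rintro (⟨S, hS, h⟩ | ⟨hkn, S, hS, h⟩)
      · exact ⟨S, hS.trans (Finset.subset_insert _ _), h⟩
      · refine ⟨insert k S, Finset.insert_subset_insert _ hS, ?_⟩
        rw [Finset.sum_insert fun h' => hk (List.mem_toFinset.1 (hS h')), h]
        omega
    · rintro ⟨S, hS, h⟩
      by_cases hkS : k ∈ S
      · rw [← Finset.add_sum_erase S _ hkS] at h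
        exact Or.inr ⟨by omega, S.erase k, Finset.subset_insert_iff.1 hS, by omega⟩
      · exact Or.inl ⟨S, (Finset.subset_insert_iff_of_notMem hkS).1 hS, h⟩

/-- A run of `b` ones from bit `a` on settles a whole interval by a single evaluation of the mask.
-/
theorem exists_sum_sq_of_mask {l : List ℕ} (hl : l.Nodup) (a b : ℕ)
    (h : squareSumMask l >>> a % 2 ^ b = 2 ^ b - 1) {n : ℕ} (ha : a ≤ n) (hb : n < a + b) :
    ∃ S ⊆ l.toFinset, ∑ i ∈ S, i ^ 2 = n := by
  rw [← testBit_squareSumMask hl]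
  have h := congrArg (Nat.testBit · (n - a)) h
  have hb : n - a < b := by omega
  simpa [Nat.testBit_mod_two_pow, hb, Nat.testBit_shiftRight, Nat.add_sub_cancel' ha] using h

set_option exponentiation.threshold 400 in
/-- Every integer from `189` on is a sum of distinct squares of integers prime to `5`. -/
theorem exists_sum_sq_not_five_dvd (n : ℕ) (hn : 189 ≤ n) :
    ∃ S : Finset ℕ, (∀ i ∈ S, ¬ 5 ∣ i) ∧ ∑ i ∈ S, i ^ 2 = n := by
  induction n using Nat.strong_induction_on with
  | _ n ih =>
  rcases lt_or_ge n 513 with hn' | hn'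
  -- The interval has length `324 = 18 ^ 2`, so that `s ≥ 18` in the other case.
  · obtain ⟨S, hS, h⟩ := exists_sum_sq_of_mask (l := [1, 2, 3, 4, 6, 7, 8, 9, 11, 12, 13, 14])
      (by decide) 189 324 (by decide) hn hn'
    refine ⟨S, fun i hi => ?_, h⟩
    have : ∀ i ∈ [1, 2, 3, 4, 6, 7, 8, 9, 11, 12, 13, 14], ¬ 5 ∣ i := by decide
    exact this i (List.mem_toFinset.1 (hS hi))
  -- Greedy step: remove `k ^ 2`, where `k` is `s` or `s - 1` and prime to 5. The remainder is at
  -- least 189, and it is less than `k ^ 2`, so `k` is not used again.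
  · obtain ⟨s, hs⟩ : ∃ s, s = Nat.sqrt (n - 189) := ⟨_, rfl⟩
    have hs₁ : s * s ≤ n - 189 := hs ▸ Nat.sqrt_le _
    have hs₂ : n - 189 ≤ s * s + s + s := hs ▸ Nat.sqrt_le_add _
    have hs₃ : 18 ≤ s := hs ▸ Nat.le_sqrt.2 (by omega)
    obtain ⟨k, hk, hks, hk'⟩ : ∃ k, ¬ 5 ∣ k ∧ k ≤ s ∧ s ≤ k + 1 := by
      by_cases h : 5 ∣ s
      · exact ⟨s - 1, by omega, by omega, by omega⟩
      · exact ⟨s, h, le_rfl, by omega⟩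
    have hkn : k ^ 2 + 189 ≤ n := by
      have : k ^ 2 ≤ s * s := by nlinarith
      omega
    -- In the worst case `k = s - 1` this follows from `s ^ 2 + 2 * s + 189 < 2 * (s - 1) ^ 2`, that
    -- is `(s - 17) * (s + 11) > 0`; hence the need for `s ≥ 18`.
    have hnk : n < 2 * k ^ 2 := by
      have h₁ : n ≤ s * s + s + s + 189 := by omega
      nlinarith
    have hk0 : 0 < k ^ 2 := by omega
    obtain ⟨S, hS, h⟩ := ih (n - k ^ 2) (by omega) (by omega)
    refine ⟨insert k S, ?_, ?_⟩
    · simpa [hk] using hS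
    · rw [Finset.sum_insert, h]
      · omega
      · intro hkS
        have := Finset.single_le_sum (f := fun i => i ^ 2) (fun _ _ => Nat.zero_le _) hkS
        omega

theorem nonempty_squareSet (n : ℕ) (hn : 129 ≤ n) : Nonempty (SquareSet n) := by
  rcases lt_or_ge n 189 with hn' | hn'
  -- The gap from 129 to 188 is closed by allowing multiples of 5 as well.
  · obtain ⟨S, hS, h⟩ := exists_sum_sq_of_mask (l := [1, 2, 3, 4, 5, 6, 7, 8, 9, 10])
      (by decide) 129 60 (by decide) hn hn'
    exact ⟨S, fun h0 => by simpa using hS h0, h⟩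
  · obtain ⟨S, hS, h⟩ := exists_sum_sq_not_five_dvd n hn'
    exact ⟨S, fun h0 => hS 0 h0 (dvd_zero 5), h⟩

theorem isEmpty_squareSet : IsEmpty (SquareSet 128) := by
  refine ⟨fun S => ?_⟩
  have h : (squareSumMask [1, 2, 3, 4, 5, 6, 7, 8, 9, 10, 11]).testBit 128 = true := by
    refine (testBit_squareSumMask (by decide) _).2 ⟨S.1, fun i hi => ?_, S.2.2⟩
    have h₁ := Finset.mem_Icc.1 (S.subset_Icc hi)
    have h₂ := Finset.single_le_sum (f := fun i => i ^ 2) (fun _ _ => Nat.zero_le _) hi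
    rw [S.2.2] at h₂
    have h₃ : i ≤ 11 := by nlinarith
    have h₄ := h₁.1
    interval_cases i <;> decide
  exact absurd h (by decide)

theorem isGreatest_distinctSquarePartitions :
    IsGreatest {n : ℕ | distinctSquarePartitions n = 0} 128 := by
  constructor
  · rw [Set.mem_ofPred_eq, distinctSquarePartitions_eq, Nat.card_eq_zero]
    exact Or.inl isEmpty_squareSet
  · intro n hn
    rw [Set.mem_ofPred_eq, distinctSquarePartitions_eq] at hn
    by_contra! h
    have := nonempty_squareSet n h
    exact Nat.card_pos.ne' hn

/-! ### Growth of the number of partitions -/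

/-- Arbitrary sets of multiples of `5` can be completed by integers prime to `5`. -/
theorem two_pow_le_card_squareSet (n k : ℕ) (h : 25 * k ^ 3 + 189 ≤ n) :
    2 ^ k ≤ Nat.card (SquareSet n) := by
  have hT (T : (Finset.Icc 1 k).powerset) : 25 * ∑ i ∈ T.1, i ^ 2 + 189 ≤ n := by
    have : ∑ i ∈ T.1, i ^ 2 ≤ k ^ 3 := by
      calc ∑ i ∈ T.1, i ^ 2 ≤ ∑ i ∈ Finset.Icc 1 k, i ^ 2 :=
            Finset.sum_le_sum_of_subset (Finset.mem_powerset.1 T.2)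
        _ ≤ (Finset.Icc 1 k).card • k ^ 2 :=
            Finset.sum_le_card_nsmul _ _ _ fun i hi => by
              have := (Finset.mem_Icc.1 hi).2
              gcongr
        _ = k ^ 3 := by rw [Nat.card_Icc, smul_eq_mul, Nat.add_sub_cancel]; ring
    omega
  choose R hR hRsum using fun T => exists_sum_sq_not_five_dvd (n - 25 * ∑ i ∈ T.1, i ^ 2)
    (Nat.le_sub_of_add_le' (hT T))
  have hdisj (T) : Disjoint (T.1.image (5 * ·)) (R T) := by
    refine Finset.disjoint_left.2 fun i hi hi' => hR T i hi' ?_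
    obtain ⟨j, _, rfl⟩ := Finset.mem_image.1 hi
    exact dvd_mul_right 5 j
  have hsum (T) : ∑ i ∈ T.1.image (5 * ·) ∪ R T, i ^ 2 = n := by
    have := hT T
    rw [Finset.sum_union (hdisj T), Finset.sum_image (fun _ _ _ _ h => by simpa using h), hRsum,
      Finset.sum_congr rfl fun i _ => mul_pow 5 i 2, ← Finset.mul_sum]
    omega
  have h0 (T) : 0 ∉ T.1.image (5 * ·) ∪ R T := by
    rw [Finset.mem_union]
    rintro (h | h)
    · obtain ⟨j, hj, h⟩ := Finset.mem_image.1 h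
      have := Finset.mem_Icc.1 (Finset.mem_powerset.1 T.2 hj)
      omega
    · exact hR T 0 h (dvd_zero 5)
  -- The multiples of 5 in the completed set recover `T`, which gives injectivity.
  have hfilter (T) : (T.1.image (5 * ·) ∪ R T).filter (5 ∣ ·) = T.1.image (5 * ·) := by
    rw [Finset.filter_union, Finset.filter_true_of_mem, Finset.filter_false_of_mem (hR T),
      Finset.union_empty]
    intro i hi
    obtain ⟨j, _, rfl⟩ := Finset.mem_image.1 hi
    exact dvd_mul_right 5 j
  have hcard : Nat.card (Finset.Icc 1 k).powerset = 2 ^ k := by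
    rw [Nat.card_eq_fintype_card, Fintype.card_coe, Finset.card_powerset, Nat.card_Icc,
      Nat.add_sub_cancel]
  rw [← hcard]
  refine Nat.card_le_card_of_injective
    (fun T => (⟨T.1.image (5 * ·) ∪ R T, h0 T, hsum T⟩ : SquareSet n)) fun T T' hTT' => ?_
  have h := congrArg (fun S : Finset ℕ => S.filter (5 ∣ ·)) (Subtype.mk.inj hTT')
  simp only [hfilter] at h
  exact Subtype.ext (Finset.image_injective (fun _ _ h => by simpa using h) h)

/-- The growth of the number of sets of squares. -/
theorem exp_le_distinctSquarePartitions (n : ℕ) (hn : 129 ≤ n) :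
    1 / 2 * Real.exp (Real.log 2 / 6 * (n : ℝ) ^ (1 / 3 : ℝ)) ≤
      (distinctSquarePartitions n : ℝ) := by
  -- The divisor 6 fits because `25 * k ^ 3 + 189 ≤ 216 * k ^ 3` for `k ≥ 1`, where `216 = 6 ^ 3`.
  -- The factor `1 / 2` in the bound pays for rounding `y` down.
  obtain ⟨y, hy⟩ : ∃ y : ℝ, y = (n : ℝ) ^ (1 / 3 : ℝ) / 6 := ⟨_, rfl⟩
  have hy0 : 0 ≤ y := by rw [hy]; positivity
  have hy3 : 216 * y ^ 3 = n := by
    rw [hy, div_pow, ← Real.rpow_natCast, ← Real.rpow_mul (Nat.cast_nonneg n)]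
    norm_num
    ring
  have hk : (⌊y⌋₊ : ℝ) ≤ y := Nat.floor_le hy0
  have hk3 : 216 * ⌊y⌋₊ ^ 3 ≤ n := by
    have : (216 * ⌊y⌋₊ ^ 3 : ℝ) ≤ n := by rw [← hy3]; gcongr
    exact_mod_cast this
  have hcard : 2 ^ ⌊y⌋₊ ≤ distinctSquarePartitions n := by
    rw [distinctSquarePartitions_eq]
    rcases Nat.eq_zero_or_pos ⌊y⌋₊ with h | h
    · have := nonempty_squareSet n hn
      rw [h, pow_zero]
      exact Nat.card_pos
    · have : 1 ≤ ⌊y⌋₊ ^ 3 := Nat.one_le_pow _ _ h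
      exact two_pow_le_card_squareSet n _ (by omega)
  calc 1 / 2 * Real.exp (Real.log 2 / 6 * (n : ℝ) ^ (1 / 3 : ℝ))
      = (2 : ℝ) ^ (y - 1) := by
        rw [Real.rpow_sub_one two_ne_zero, Real.rpow_def_of_pos two_pos, hy]
        ring_nf
    _ ≤ (2 : ℝ) ^ (⌊y⌋₊ : ℝ) := by
        gcongr
        · norm_num
        · linarith [Nat.lt_floor_add_one y]
    _ = (2 ^ ⌊y⌋₊ : ℕ) := by rw [Real.rpow_natCast]; norm_num
    _ ≤ (distinctSquarePartitions n : ℝ) := by exact_mod_cast hcard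

/-! ### Polynomial time in input and output -/

/-- From 129 on this is the logarithm of the growth bound, whose factor `1 / 2` is made up for by
`log (1 + n) ≥ log 2`. Below 129 the count may vanish, but there `n ^ (1/3) ≤ 6`, and `log (1 + n)`
alone suffices. -/
theorem le_inOutComplexity (n : ℕ) (hn : 1 ≤ n) :
    Real.log 2 / 6 * (n : ℝ) ^ (1 / 3 : ℝ) ≤
      inOutComplexity (fun n => (distinctSquarePartitions n : ℤ)) n := by
  have hf : (0 : ℝ) ≤ distinctSquarePartitions n := Nat.cast_nonneg _
  have hn' : (1 : ℝ) ≤ n := by exact_mod_cast hn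
  have hlog : Real.log 2 ≤ Real.log (1 + (n : ℝ)) := Real.log_le_log two_pos (by linarith)
  have hpos : 0 < Real.log 2 := Real.log_pos one_lt_two
  rw [inOutComplexity]
  push_cast
  rw [abs_of_nonneg hf]
  rcases lt_or_ge n 129 with h | h
  · have h₁ : (n : ℝ) ^ (1 / 3 : ℝ) ≤ 6 := by
      calc (n : ℝ) ^ (1 / 3 : ℝ) ≤ (6 ^ (3 : ℝ) : ℝ) ^ (1 / 3 : ℝ) := by
            gcongr
            have : (n : ℝ) ≤ 129 := by exact_mod_cast h.le
            norm_num
            linarith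
        _ = 6 := by rw [← Real.rpow_mul (by norm_num)]; norm_num
    have h₂ : 0 ≤ Real.log (2 + (distinctSquarePartitions n : ℝ)) :=
      Real.log_nonneg (by linarith)
    nlinarith
  · have h₁ : Real.log 2 / 6 * (n : ℝ) ^ (1 / 3 : ℝ) - Real.log 2 ≤
        Real.log (2 + (distinctSquarePartitions n : ℝ)) := by
      rw [Real.le_log_iff_exp_le (by linarith), Real.exp_sub, Real.exp_log two_pos]
      linarith [exp_le_distinctSquarePartitions n h]
    linarith

/-- A running time that is polynomial in `n` itself suffices, because the outputs are long. -/
theorem isPIO_distinctSquarePartitions :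
    IsPIO fun n => (distinctSquarePartitions n : ℤ) := by
  obtain ⟨M, hM⟩ := exists_machine_countSquares
  have hpos : 0 < Real.log 2 := Real.log_pos one_lt_two
  -- The exponent is `15 = 3 * 5`: the time is of order `n ^ 5`, and `n` is at most a constant times
  -- `m ^ 3`. The inner 2 comes from `n + 1 ≤ 2 * n`.
  refine ⟨M, ⌈300 * (2 * (6 / Real.log 2) ^ 3) ^ 5⌉₊, 15, Nat.ceil_pos.2 (by positivity),
    by norm_num, fun n hn => ?_⟩
  obtain ⟨t, ht, h⟩ := hM n
  refine ⟨t, ?_, ?_⟩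
  · have h₀ := le_inOutComplexity n hn
    generalize inOutComplexity _ n = m at h₀
    have h₁ : (n : ℝ) ≤ (6 / Real.log 2) ^ 3 * m ^ 3 := by
      calc (n : ℝ) = ((n : ℝ) ^ (1 / 3 : ℝ)) ^ 3 := by
            rw [← Real.rpow_natCast, ← Real.rpow_mul (Nat.cast_nonneg n)]
            norm_num
        _ = (6 / Real.log 2) ^ 3 * (Real.log 2 / 6 * (n : ℝ) ^ (1 / 3 : ℝ)) ^ 3 := by
            field_simp
        _ ≤ (6 / Real.log 2) ^ 3 * m ^ 3 := by gcongr
    have hn' : (1 : ℝ) ≤ n := by exact_mod_cast hn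
    calc (t : ℝ) ≤ 300 * ((n : ℝ) + 1) ^ 5 := by exact_mod_cast ht
      _ ≤ 300 * (2 * ((6 / Real.log 2) ^ 3 * m ^ 3)) ^ 5 := by gcongr; linarith
      _ = 300 * (2 * (6 / Real.log 2) ^ 3) ^ 5 * m ^ 15 := by ring
      _ ≤ ⌈300 * (2 * (6 / Real.log 2) ^ 3) ^ 5⌉₊ * m ^ 15 := by
          have hm : 0 ≤ m := le_trans (by positivity) h₀
          gcongr
          exact Nat.le_ceil _
  · rw [prod_div_mod, ← distinctSquarePartitions_eq] at h
    rwa [intCode, decide_eq_false (by simp), Int.natAbs_natCast]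

theorem mainTheorem7 :
    IsPIO (fun n => (distinctSquarePartitions n : ℤ)) ∧
    (∀ n : ℕ, 1 ≤ n → distinctSquarePartitions n = selfMultiplicityPartitions n) ∧
    IsGreatest {n : ℕ | distinctSquarePartitions n = 0} 128 ∧
    (∃ C c : ℝ, 0 < C ∧ 0 < c ∧ ∀ n : ℕ, 129 ≤ n →
      C * Real.exp (c * (n : ℝ) ^ (1 / 3 : ℝ)) ≤ (distinctSquarePartitions n : ℝ)) := by
  refine ⟨isPIO_distinctSquarePartitions, fun n _ => ?_, isGreatest_distinctSquarePartitions,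
    1 / 2, Real.log 2 / 6, by norm_num, by positivity, exp_le_distinctSquarePartitions⟩
  rw [distinctSquarePartitions_eq, selfMultiplicityPartitions_eq]
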